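/- Let $n\ge 1$ and $k\ge 1$ be integers, $I^n=[0,1]^n$, and let $$\mathcal K_k^n=\Big\{\prod_{s=1}^n\Big[\tfrac{i_s-1}{k},\tfrac{i_s}{k}\Big] : i_1,\dots,i_n\in\{1,\dots,k\}\Big\}$$ be the division of $I^n$ into $k^n$ cubes. A set $S\subset I^n$ *connects some opposite faces of $I^n$* if $S$ is connected and, for some $i\in\{1,\dots,n\}$, it meets both $\{z\in I^n: z_i=0\}$ and $\{z\in I^n: z_i=1\}$. A set $P\subset\mathbb Z^{n-1}$ is *$1$-connected* if any two of its points are joined by a finite sequence of points of $P$ whose consecutive terms are at $\ell^\infty$-distance at most $1$. Write $\dim$ for topological dimension, where $\dim\emptyset<0$ by convention. For $0\le m\le n-1$ call a real number $C>0$ *admissible for $(n,m)$* if for every integer $k\ge1$ and every function $F:\mathcal K_k^n\to\mathbb Z^{n-1}$ such that $\|F(K_1)-F(K_2)\|_\infty\le 1$ for all $K_1,K_2\in\mathcal K_k^n$ with $\dim(K_1\cap K_2)\ge m$, there exist a $1$-connected set $P\subset\mathbb Z^{n-1}$ with $|P|\le C$ and a family $\mathcal S\subset F^{-1}[P]$ such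 that $\bigcup\mathcal S$ connects some opposite faces of $I^n$. Let $\widehat C_{n,m}$ denote the minimum of all admissible constants for $(n,m)$. Then $\widehat C_{3,0}=2$; that is, $2$ is admissible for $(3,0)$, and no real number $0<C<2$ is admissible for $(3,0)$. -/

import Mathlib

namespace Chessboard

/-- The topological dimension of a subset `A` of `ℝ^n`, with `dim ∅ = ⊥`. For subsets of `ℝ^n`
the inductive and the covering dimensions coincide. -/
noncomputable def topDim {n : ℕ} (A : Set (Fin n → ℝ)) : WithBot ℕ∞ :=
  smallInductiveDimension A

/-- The unit cube `I^n = [0, 1]^n`. -/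
def unitCube (n : ℕ) : Set (Fin n → ℝ) :=
  Set.univ.pi fun _ => Set.Icc (0 : ℝ) 1

/-- The cube `∏ s, [i_s / k, (i_s + 1) / k]`, where the indices `i_s` run over `0, …, k - 1`. -/
def cube (n k : ℕ) (i : Fin n → Fin k) : Set (Fin n → ℝ) :=
  Set.univ.pi fun s => Set.Icc (((i s : ℕ) : ℝ) / (k : ℝ)) ((((i s : ℕ) : ℝ) + 1) / (k : ℝ))

/-- The family `𝒦_k^n` of the `k^n` cubes into which `I^n` is divided. -/
def cubes (n k : ℕ) : Set (Set (Fin n → ℝ)) :=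
  Set.range (cube n k)

/-- `S ⊆ I^n` connects the `i`th opposite faces `{z ∈ I^n | z_i = 0}`, `{z ∈ I^n | z_i = 1}`. -/
def ConnectsOppositeFaces {n : ℕ} (i : Fin n) (S : Set (Fin n → ℝ)) : Prop :=
  S ⊆ unitCube n ∧ IsConnected S ∧
    (S ∩ {z | z ∈ unitCube n ∧ z i = 0}).Nonempty ∧
    (S ∩ {z | z ∈ unitCube n ∧ z i = 1}).Nonempty

/-- `S` connects some opposite faces of `I^n`. -/
def ConnectsSomeOppositeFaces {n : ℕ} (S : Set (Fin n → ℝ)) : Prop :=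
  ∃ i : Fin n, ConnectsOppositeFaces i S

/-- `S` is `r`-connected: any two of its points are joined by a finite sequence of points of `S`
whose consecutive terms are at distance at most `r`. -/
def RConnected {X : Type*} [MetricSpace X] (r : ℝ) (S : Set X) : Prop :=
  ∀ x ∈ S, ∀ y ∈ S, ∃ (N : ℕ) (p : Fin (N + 1) → X),
    (∀ j, p j ∈ S) ∧ p 0 = x ∧ p (Fin.last N) = y ∧
      ∀ j : Fin N, dist (p j.castSucc) (p j.succ) ≤ r

/-- `C` is an admissible constant in dimension `n ≥ 1` with parameter `0 ≤ m ≤ n - 1`: for every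
`k ≥ 1` and every `F : 𝒦_k^n → ℤ^(n-1)` with `‖F K₁ - F K₂‖_∞ ≤ 1` whenever
`dim (K₁ ∩ K₂) ≥ m`, there are a `1`-connected `P ⊆ ℤ^(n-1)` with `|P| ≤ C` and a family
`𝒮 ⊆ F⁻¹[P]` whose union connects some opposite faces of `I^n`.
Norm and distance on `Fin (n - 1) → ℤ` are those of `l^∞`. -/
def AdmissibleConst (n m : ℕ) (C : ℝ) : Prop :=
  ∀ (k : ℕ), 1 ≤ k → ∀ F : cubes n k → (Fin (n - 1) → ℤ),
    (∀ K₁ K₂ : cubes n k,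
      (m : WithBot ℕ∞) ≤ topDim ((K₁ : Set (Fin n → ℝ)) ∩ (K₂ : Set (Fin n → ℝ))) →
        ‖F K₁ - F K₂‖ ≤ 1) →
    ∃ P : Finset (Fin (n - 1) → ℤ),
      RConnected 1 (P : Set (Fin (n - 1) → ℤ)) ∧ (P.card : ℝ) ≤ C ∧
      ∃ 𝒮 : Set (cubes n k), 𝒮 ⊆ F ⁻¹' (P : Set (Fin (n - 1) → ℤ)) ∧
        ConnectsSomeOppositeFaces (⋃ K ∈ 𝒮, (K : Set (Fin n → ℝ)))

/-- `C` is the optimal constant `Ĉ_{n,m}`: the minimum of all admissible constants `C > 0`. -/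
def IsOptimalConst (n m : ℕ) (C : ℝ) : Prop :=
  IsLeast {c : ℝ | 0 < c ∧ AdmissibleConst n m c} C

end Chessboard

/-! Upper bound: tile `ℤ²` by dominoes in running bond and colour each cube by the domino containing
its value. If no monochromatic component crosses, label a cube by the first coordinate `i` for which
its component touches the face `z_i = 0`, or by `3` if there is none. These labels satisfy the
boundary conditions of Kuhn's cubical Sperner lemma (`exists_cell_all_labels`), so some `2 × 2 × 2`
cell carries all four labels. Its cubes share a vertex, so four of them lie in distinct components
and have four distinct colours. But their values are pairwise at distance at most `1`, and such
values meet at most three dominoes (`exists_brick_eq`).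

Lower bound: the points of a unit square are pairwise at distance at most `1`, so every
four-colouring gives a legitimate `F`. In `fourColouring` the cubes of each monochromatic component
touch pairwise, so none crosses the `3 × 3 × 3` board, and one value does not suffice. -/

namespace Chessboard

open Finset Relation

/-! ### Kuhn's cubical Sperner lemma modulo 2 -/

/-- The indicator of `{a, b} = {0, 1}`. -/
def edgeIndicator (a b : Fin 4) : ZMod 2 :=
  if (a = 0 ∧ b = 1) ∨ (a = 1 ∧ b = 0) then 1 else 0

/-- The indicator of `{a, b, c} = {0, 1, 2}`. -/
def triangleIndicator (a b c : Fin 4) : ZMod 2 :=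
  if a ≠ b ∧ a ≠ c ∧ b ≠ c ∧ a ≠ 3 ∧ b ≠ 3 ∧ c ≠ 3 then 1 else 0

/-- The indicator of `{a, b, c, d} = {0, 1, 2, 3}`. -/
def tetrahedronIndicator (a b c d : Fin 4) : ZMod 2 :=
  if a ≠ b ∧ a ≠ c ∧ a ≠ d ∧ b ≠ c ∧ b ≠ d ∧ c ≠ d then 1 else 0

theorem edgeIndicator_eq : ∀ a b : Fin 4, a ≤ 1 → b ≤ 1 →
    edgeIndicator a b = (if b = 0 then 1 else 0) + (if a = 0 then 1 else 0) := by
  decide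

theorem triangleIndicator_eq : ∀ a b c : Fin 4, a ≤ 2 → b ≤ 2 → c ≤ 2 →
    triangleIndicator a b c = edgeIndicator b c + edgeIndicator a c + edgeIndicator a b := by
  decide

/-- The parity step of Sperner's lemma: a fully labelled simplex has exactly one face labelled `{0,
1, 2}`, any other simplex has none or two. -/
theorem tetrahedronIndicator_eq : ∀ a b c d : Fin 4,
    tetrahedronIndicator a b c d = triangleIndicator b c d + triangleIndicator a c d +
      triangleIndicator a b d + triangleIndicator a b c := by
  decide

theorem edgeIndicator_eq_zero : ∀ l a b : Fin 4, l ≤ 1 → a ≠ l → b ≠ l →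
    edgeIndicator a b = 0 := by
  decide

theorem triangleIndicator_eq_zero : ∀ l a b c : Fin 4, l ≤ 2 → a ≠ l → b ≠ l → c ≠ l →
    triangleIndicator a b c = 0 := by
  decide

theorem exists_eq_of_tetrahedronIndicator_ne_zero : ∀ a b c d : Fin 4,
    tetrahedronIndicator a b c d ≠ 0 → ∀ l, l = a ∨ l = b ∨ l = c ∨ l = d := by
  decide

theorem sum_range_succ_add_self (f : ℕ → ZMod 2) (m : ℕ) :
    ∑ x ∈ range m, (f (x + 1) + f x) = f m + f 0 := by
  simpa [CharTwo.sub_eq_add] using Finset.sum_range_sub f m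

/-- The one-dimensional case of Kuhn's cubical Sperner lemma, with multiplicities mod `2`. -/
theorem sum_edgeIndicator_eq_one (m : ℕ) (L : ℕ → Fin 4) (h : ∀ x ≤ m, L x ≤ 1)
    (h0 : L 0 = 0) (hm : L m ≠ 0) :
    ∑ x ∈ range m, edgeIndicator (L x) (L (x + 1)) = 1 := by
  have : ∀ x ∈ range m, edgeIndicator (L x) (L (x + 1)) =
      (if L (x + 1) = 0 then 1 else 0) + (if L x = 0 then 1 else 0) := fun x hx => by
    have hx := mem_range.1 hx
    exact edgeIndicator_eq _ _ (h _ (by omega)) (h _ (by omega))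
  rw [sum_congr rfl this, sum_range_succ_add_self (fun x => if L x = 0 then 1 else 0)]
  simp [h0, hm]

/-- The two-dimensional case of Kuhn's cubical Sperner lemma, with multiplicities mod `2`. -/
theorem sum_triangleIndicator_eq_one (m : ℕ) (L : ℕ → ℕ → Fin 4)
    (h : ∀ x ≤ m, ∀ y ≤ m, L x y ≤ 2)
    (hx0 : ∀ y ≤ m, L 0 y = 0) (hxm : ∀ y ≤ m, L m y ≠ 0)
    (hy0 : ∀ x ≤ m, L x 0 ≤ 1) (hym : ∀ x ≤ m, L x m ≠ 1) :
    ∑ x ∈ range m, ∑ y ∈ range m,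
      (triangleIndicator (L x y) (L (x + 1) y) (L (x + 1) (y + 1)) +
        triangleIndicator (L x y) (L x (y + 1)) (L (x + 1) (y + 1))) = 1 := by
  let X : ℕ → ℕ → ZMod 2 := fun x y => edgeIndicator (L x y) (L x (y + 1))
  let Y : ℕ → ℕ → ZMod 2 := fun x y => edgeIndicator (L x y) (L (x + 1) y)
  have key : ∀ x ∈ range m, ∀ y ∈ range m,
      triangleIndicator (L x y) (L (x + 1) y) (L (x + 1) (y + 1)) +
        triangleIndicator (L x y) (L x (y + 1)) (L (x + 1) (y + 1)) =
      (X (x + 1) y + X x y) + (Y x (y + 1) + Y x y) := fun x hx y hy => by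
    have hx := mem_range.1 hx
    have hy := mem_range.1 hy
    have h2 : (2 : ZMod 2) = 0 := rfl
    rw [triangleIndicator_eq _ _ _ (h _ (by omega) _ (by omega)) (h _ (by omega) _ (by omega))
        (h _ (by omega) _ (by omega)),
      triangleIndicator_eq _ _ _ (h _ (by omega) _ (by omega)) (h _ (by omega) _ (by omega))
        (h _ (by omega) _ (by omega))]
    -- The diagonal belongs to both triangles of the square, so it cancels mod 2.
    linear_combination edgeIndicator (L x y) (L (x + 1) (y + 1)) * h2
  rw [sum_congr rfl fun x hx => sum_congr rfl (key x hx)]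
  simp only [sum_add_distrib (f := fun y => X _ y + X _ y)]
  have hX : ∑ x ∈ range m, ∑ y ∈ range m, (X (x + 1) y + X x y) = 0 := by
    rw [sum_comm]
    refine sum_eq_zero fun y hy => ?_
    have hy := mem_range.1 hy
    rw [sum_range_succ_add_self (fun x => X x y)]
    simp only [X]
    rw [edgeIndicator_eq_zero 0 _ _ (by decide) (hxm _ (by omega)) (hxm _ (by omega)),
      hx0 _ (by omega), hx0 _ (by omega)]
    rfl
  have hY : ∑ x ∈ range m, ∑ y ∈ range m, (Y x (y + 1) + Y x y) = 1 := by
    rw [← sum_edgeIndicator_eq_one m (fun x => L x 0) hy0 (hx0 _ (Nat.zero_le _))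
      (hxm _ (Nat.zero_le _))]
    refine sum_congr rfl fun x hx => ?_
    have hx := mem_range.1 hx
    rw [sum_range_succ_add_self (fun y => Y x y)]
    simp only [Y]
    rw [edgeIndicator_eq_zero 1 _ _ (by decide) (hym _ (by omega)) (hym _ (by omega)), zero_add]
  rw [sum_add_distrib, hX, hY, zero_add]

/-- The three-dimensional case of Kuhn's cubical Sperner lemma. -/
theorem exists_cell_all_labels (m : ℕ) (L : ℕ → ℕ → ℕ → Fin 4)
    (hx0 : ∀ y ≤ m, ∀ z ≤ m, L 0 y z = 0) (hxm : ∀ y ≤ m, ∀ z ≤ m, L m y z ≠ 0)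
    (hy0 : ∀ x ≤ m, ∀ z ≤ m, L x 0 z ≤ 1) (hym : ∀ x ≤ m, ∀ z ≤ m, L x m z ≠ 1)
    (hz0 : ∀ x ≤ m, ∀ y ≤ m, L x y 0 ≤ 2) (hzm : ∀ x ≤ m, ∀ y ≤ m, L x y m ≠ 2) :
    ∃ x y z, x < m ∧ y < m ∧ z < m ∧
      ∀ l, ∃ a ≤ 1, ∃ b ≤ 1, ∃ c ≤ 1, L (x + a) (y + b) (z + c) = l := by
  let X : ℕ → ℕ → ℕ → ZMod 2 := fun x y z =>
    triangleIndicator (L x y z) (L x (y + 1) z) (L x (y + 1) (z + 1)) +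
      triangleIndicator (L x y z) (L x y (z + 1)) (L x (y + 1) (z + 1))
  let Y : ℕ → ℕ → ℕ → ZMod 2 := fun x y z =>
    triangleIndicator (L x y z) (L (x + 1) y z) (L (x + 1) y (z + 1)) +
      triangleIndicator (L x y z) (L x y (z + 1)) (L (x + 1) y (z + 1))
  let Z : ℕ → ℕ → ℕ → ZMod 2 := fun x y z =>
    triangleIndicator (L x y z) (L (x + 1) y z) (L (x + 1) (y + 1) z) +
      triangleIndicator (L x y z) (L x (y + 1) z) (L (x + 1) (y + 1) z)
  -- Kuhn's triangulation: one tetrahedron for each monotone edge path from `o` to `e`.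
  let T : ℕ → ℕ → ℕ → ZMod 2 := fun x y z =>
    let t := tetrahedronIndicator
    let o := L x y z
    let e := L (x + 1) (y + 1) (z + 1)
    t o (L (x + 1) y z) (L (x + 1) (y + 1) z) e + t o (L (x + 1) y z) (L (x + 1) y (z + 1)) e +
    t o (L x (y + 1) z) (L (x + 1) (y + 1) z) e + t o (L x (y + 1) z) (L x (y + 1) (z + 1)) e +
    t o (L x y (z + 1)) (L (x + 1) y (z + 1)) e + t o (L x y (z + 1)) (L x (y + 1) (z + 1)) e
  have key : ∀ x y z, T x y z =
      (X (x + 1) y z + X x y z) + (Y x (y + 1) z + Y x y z) + (Z x y (z + 1) + Z x y z) := by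
    intro x y z
    have h2 : (2 : ZMod 2) = 0 := rfl
    simp only [T, X, Y, Z, tetrahedronIndicator_eq]
    let t := triangleIndicator
    let o := L x y z
    let e := L (x + 1) (y + 1) (z + 1)
    -- The six triangles containing the main diagonal are each shared by two tetrahedra.
    linear_combination (t o (L (x + 1) y z) e + t o (L x (y + 1) z) e + t o (L x y (z + 1)) e +
      t o (L (x + 1) (y + 1) z) e + t o (L (x + 1) y (z + 1)) e + t o (L x (y + 1) (z + 1)) e) * h2
  have hX : ∑ x ∈ range m, ∑ y ∈ range m, ∑ z ∈ range m, (X (x + 1) y z + X x y z) = 0 := by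
    rw [sum_comm]
    refine sum_eq_zero fun y hy => ?_
    rw [sum_comm]
    refine sum_eq_zero fun z hz => ?_
    have hy := mem_range.1 hy
    have hz := mem_range.1 hz
    rw [sum_range_succ_add_self (fun x => X x y z)]
    have hm (a b : ℕ) (ha : a ≤ m) (hb : b ≤ m) := hxm a ha b hb
    simp only [X]
    rw [hx0 _ (by omega) _ (by omega), hx0 _ (by omega) _ (by omega),
      hx0 _ (by omega) _ (by omega), hx0 _ (by omega) _ (by omega),
      triangleIndicator_eq_zero 0 _ _ _ (by decide) (hm _ _ (by omega) (by omega))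
        (hm _ _ (by omega) (by omega)) (hm _ _ (by omega) (by omega)),
      triangleIndicator_eq_zero 0 _ _ _ (by decide) (hm _ _ (by omega) (by omega))
        (hm _ _ (by omega) (by omega)) (hm _ _ (by omega) (by omega))]
    rfl
  have hY : ∑ x ∈ range m, ∑ y ∈ range m, ∑ z ∈ range m, (Y x (y + 1) z + Y x y z) = 0 := by
    refine sum_eq_zero fun x hx => ?_
    rw [sum_comm]
    refine sum_eq_zero fun z hz => ?_
    have hx := mem_range.1 hx
    have hz := mem_range.1 hz
    rw [sum_range_succ_add_self (fun y => Y x y z)]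
    have h0 (a b : ℕ) (ha : a ≤ m) (hb : b ≤ m) : L a 0 b ≠ 2 := fun h =>
      absurd (h ▸ hy0 a ha b hb) (by decide)
    have hm (a b : ℕ) (ha : a ≤ m) (hb : b ≤ m) := hym a ha b hb
    simp only [Y]
    rw [triangleIndicator_eq_zero 1 _ _ _ (by decide) (hm _ _ (by omega) (by omega))
        (hm _ _ (by omega) (by omega)) (hm _ _ (by omega) (by omega)),
      triangleIndicator_eq_zero 1 _ _ _ (by decide) (hm _ _ (by omega) (by omega))
        (hm _ _ (by omega) (by omega)) (hm _ _ (by omega) (by omega)),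
      triangleIndicator_eq_zero 2 _ _ _ (by decide) (h0 _ _ (by omega) (by omega))
        (h0 _ _ (by omega) (by omega)) (h0 _ _ (by omega) (by omega)),
      triangleIndicator_eq_zero 2 _ _ _ (by decide) (h0 _ _ (by omega) (by omega))
        (h0 _ _ (by omega) (by omega)) (h0 _ _ (by omega) (by omega))]
    rfl
  -- Only the face `z = 0` contributes: every other face misses a label in `{0, 1, 2}` or is
  -- constant.
  have hZ : ∑ x ∈ range m, ∑ y ∈ range m, ∑ z ∈ range m, (Z x y (z + 1) + Z x y z) = 1 := by
    rw [← sum_triangleIndicator_eq_one m (fun x y => L x y 0) hz0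
      (fun y hy => hx0 y hy 0 (Nat.zero_le _)) (fun y hy => hxm y hy 0 (Nat.zero_le _))
      (fun x hx => hy0 x hx 0 (Nat.zero_le _)) (fun x hx => hym x hx 0 (Nat.zero_le _))]
    refine sum_congr rfl fun x hx => sum_congr rfl fun y hy => ?_
    have hx := mem_range.1 hx
    have hy := mem_range.1 hy
    rw [sum_range_succ_add_self (fun z => Z x y z)]
    have hm (a b : ℕ) (ha : a ≤ m) (hb : b ≤ m) := hzm a ha b hb
    simp only [Z]
    rw [triangleIndicator_eq_zero 2 _ _ _ (by decide) (hm _ _ (by omega) (by omega))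
        (hm _ _ (by omega) (by omega)) (hm _ _ (by omega) (by omega)),
      triangleIndicator_eq_zero 2 _ _ _ (by decide) (hm _ _ (by omega) (by omega))
        (hm _ _ (by omega) (by omega)) (hm _ _ (by omega) (by omega)), add_zero, zero_add]
  have hT : ∑ x ∈ range m, ∑ y ∈ range m, ∑ z ∈ range m, T x y z = 1 := by
    simp only [key]
    rw [← zero_add (1 : ZMod 2), ← zero_add (0 + 1 : ZMod 2)]
    nth_rw 1 [← hX]
    nth_rw 1 [← hY]
    rw [← hZ]
    simp only [← sum_add_distrib, add_assoc]
  obtain ⟨x, hx, h⟩ := exists_ne_zero_of_sum_ne_zero (hT ▸ one_ne_zero)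
  obtain ⟨y, hy, h⟩ := exists_ne_zero_of_sum_ne_zero h
  obtain ⟨z, hz, h⟩ := exists_ne_zero_of_sum_ne_zero h
  refine ⟨x, y, z, mem_range.1 hx, mem_range.1 hy, mem_range.1 hz, fun l => ?_⟩
  by_contra! hl
  have hl (a b c : ℕ) (ha : a ≤ 1) (hb : b ≤ 1) (hc : c ≤ 1) : l ≠ L (x + a) (y + b) (z + c) :=
    fun h => hl a ha b hb c hc h.symm
  have h000 : l ≠ L x y z := hl 0 0 0 (by omega) (by omega) (by omega)
  have h001 : l ≠ L x y (z + 1) := hl 0 0 1 (by omega) (by omega) (by omega)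
  have h010 : l ≠ L x (y + 1) z := hl 0 1 0 (by omega) (by omega) (by omega)
  have h011 : l ≠ L x (y + 1) (z + 1) := hl 0 1 1 (by omega) (by omega) (by omega)
  have h100 : l ≠ L (x + 1) y z := hl 1 0 0 (by omega) (by omega) (by omega)
  have h101 : l ≠ L (x + 1) y (z + 1) := hl 1 0 1 (by omega) (by omega) (by omega)
  have h110 : l ≠ L (x + 1) (y + 1) z := hl 1 1 0 (by omega) (by omega) (by omega)
  have h111 : l ≠ L (x + 1) (y + 1) (z + 1) := hl 1 1 1 (by omega) (by omega) (by omega)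
  have zero {a b c d : Fin 4} (ha : l ≠ a) (hb : l ≠ b) (hc : l ≠ c) (hd : l ≠ d) :
      tetrahedronIndicator a b c d = 0 := by
    by_contra h
    rcases exists_eq_of_tetrahedronIndicator_ne_zero a b c d h l with h | h | h | h
    exacts [ha h, hb h, hc h, hd h]
  apply h
  simp only [T]
  rw [zero h000 h100 h110 h111, zero h000 h100 h101 h111, zero h000 h010 h110 h111,
    zero h000 h010 h011 h111, zero h000 h001 h101 h111, zero h000 h001 h011 h111]
  rfl

/-! ### Adjacency of cubes and monochromatic components -/

theorem zero_le_topDim_iff {n : ℕ} {A : Set (Fin n → ℝ)} :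
    ((0 : ℕ) : WithBot ℕ∞) ≤ topDim A ↔ A.Nonempty := by
  rw [topDim, ← not_lt, smallInductiveDimension_lt_iff, hasSmallInductiveDimensionLT_zero_iff,
    Set.isEmpty_coe_sort, Set.nonempty_iff_ne_empty]

/-- Two index vectors differ by at most `1` in each coordinate. -/
def IsNear {n k : ℕ} (u v : Fin n → Fin k) : Prop :=
  ∀ s, (u s : ℕ) ≤ v s + 1 ∧ (v s : ℕ) ≤ u s + 1

theorem IsNear.symm {n k : ℕ} {u v : Fin n → Fin k} (h : IsNear u v) : IsNear v u :=
  fun s => (h s).symm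

theorem cube_inter_cube_nonempty_iff {n k : ℕ} (hk : 1 ≤ k) {u v : Fin n → Fin k} :
    (cube n k u ∩ cube n k v).Nonempty ↔ IsNear u v := by
  have hk : (0 : ℝ) < k := by exact_mod_cast hk
  constructor
  · rintro ⟨z, hu, hv⟩ s
    have hu := hu s (Set.mem_univ s)
    have hv := hv s (Set.mem_univ s)
    have h1 := hu.1.trans hv.2
    have h2 := hv.1.trans hu.2
    rw [div_le_div_iff_of_pos_right hk] at h1 h2
    exact ⟨by exact_mod_cast h1, by exact_mod_cast h2⟩
  · intro h
    have h1 (s) : ((u s : ℕ) : ℝ) ≤ (v s : ℕ) + 1 := by exact_mod_cast (h s).1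
    have h2 (s) : ((v s : ℕ) : ℝ) ≤ (u s : ℕ) + 1 := by exact_mod_cast (h s).2
    -- The larger of the two lower corners, coordinatewise, lies in both cubes.
    refine ⟨fun s => max ((u s : ℕ) : ℝ) (v s : ℕ) / (k : ℝ), fun s _ => ?_, fun s _ => ?_⟩ <;>
      simp only [Set.mem_Icc, div_le_div_iff_of_pos_right hk]
    · exact ⟨le_max_left _ _, max_le (by linarith) (h2 s)⟩
    · exact ⟨le_max_right _ _, max_le (h1 s) (by linarith)⟩

theorem cube_subset_unitCube {n k : ℕ} (hk : 1 ≤ k) (u : Fin n → Fin k) :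
    cube n k u ⊆ unitCube n := by
  intro z hz s _
  have hk : (0 : ℝ) < k := by exact_mod_cast hk
  have h := hz s (Set.mem_univ s)
  refine ⟨le_trans (by positivity) h.1, h.2.trans ?_⟩
  rw [div_le_one hk]
  exact_mod_cast (u s).2

theorem isConnected_cube {n k : ℕ} (hk : 1 ≤ k) (u : Fin n → Fin k) :
    IsConnected (cube n k u) := by
  refine ⟨?_, ?_⟩
  · have := (cube_inter_cube_nonempty_iff hk (u := u) (v := u)).2 fun s => by omega
    rwa [Set.inter_self] at this
  · exact isPreconnected_univ_pi fun _ => isPreconnected_Icc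

theorem isClosed_cube {n k : ℕ} (u : Fin n → Fin k) : IsClosed (cube n k u) :=
  isClosed_set_pi fun _ _ => isClosed_Icc

/-- The relation between cubes that meet and have values in the same class of `β`. -/
def Linked {n k : ℕ} {β : Type*} (g : (Fin n → Fin k) → β) (u v : Fin n → Fin k) : Prop :=
  IsNear u v ∧ g u = g v

theorem Linked.symm {n k : ℕ} {β : Type*} {g : (Fin n → Fin k) → β} {u v : Fin n → Fin k}
    (h : Linked g u v) : Linked g v u :=
  ⟨h.1.symm, h.2.symm⟩

theorem eq_of_reflTransGen_linked {n k : ℕ} {β : Type*} {g : (Fin n → Fin k) → β}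
    {u v : Fin n → Fin k} (h : ReflTransGen (Linked g) u v) : g u = g v := by
  induction h with
  | refl => rfl
  | tail _ h ih => exact ih.trans h.2

/-- The cubes that are joined to the cube with index `u` by a chain of linked cubes. -/
def linkComponent {n k : ℕ} {β : Type*} (g : (Fin n → Fin k) → β) (u : Fin n → Fin k) :
    Set (cubes n k) :=
  {K | ∃ w, ReflTransGen (Linked g) u w ∧ K = ⟨cube n k w, w, rfl⟩}

theorem isConnected_biUnion_linkComponent {n k : ℕ} (hk : 1 ≤ k) {β : Type*}
    (g : (Fin n → Fin k) → β) (u : Fin n → Fin k) :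
    IsConnected (⋃ K ∈ linkComponent g u, (K : Set (Fin n → ℝ))) := by
  let c (w : Fin n → Fin k) : cubes n k := ⟨cube n k w, w, rfl⟩
  let R (K K' : cubes n k) : Prop :=
    ((K : Set (Fin n → ℝ)) ∩ (K' : Set (Fin n → ℝ))).Nonempty ∧ K ∈ linkComponent g u
  have key (w) (hw : ReflTransGen (Linked g) u w) :
      ReflTransGen R (c u) (c w) ∧ ReflTransGen R (c w) (c u) := by
    induction hw with
    | refl => exact ⟨.refl, .refl⟩
    | @tail v w hv hvw ih =>
      exact ⟨ih.1.tail ⟨(cube_inter_cube_nonempty_iff hk).2 hvw.1, v, hv, rfl⟩,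
        ih.2.head ⟨(cube_inter_cube_nonempty_iff hk).2 hvw.1.symm, w, hv.tail hvw, rfl⟩⟩
  refine IsConnected.biUnion_of_reflTransGen ⟨c u, u, .refl, rfl⟩ ?_ ?_
  · rintro _ ⟨w, -, rfl⟩
    exact isConnected_cube hk w
  · rintro _ ⟨v, hv, rfl⟩ _ ⟨w, hw, rfl⟩
    exact (key v hv).2.trans (key w hw).1

theorem connectsOppositeFaces_linkComponent {n m : ℕ} {β : Type*}
    (g : (Fin n → Fin (m + 1)) → β) {u v w : Fin n → Fin (m + 1)} {i : Fin n}
    (hv : ReflTransGen (Linked g) u v) (hw : ReflTransGen (Linked g) u w)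
    (hv0 : (v i : ℕ) = 0) (hwm : (w i : ℕ) = m) :
    ConnectsOppositeFaces i (⋃ K ∈ linkComponent g u, (K : Set (Fin n → ℝ))) := by
  have hk : 1 ≤ m + 1 := by omega
  have hk' : (0 : ℝ) < (m + 1 : ℕ) := by positivity
  refine ⟨?_, isConnected_biUnion_linkComponent hk g u, ?_, ?_⟩
  · rintro z hz
    simp only [Set.mem_iUnion] at hz
    obtain ⟨_, ⟨w, -, rfl⟩, hz⟩ := hz
    exact cube_subset_unitCube hk w hz
  · let z : Fin n → ℝ := fun s => (v s : ℕ) / ((m + 1 : ℕ) : ℝ)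
    have hz : z ∈ cube n (m + 1) v := fun s _ =>
      ⟨le_rfl, (div_le_div_iff_of_pos_right hk').2 (by linarith)⟩
    exact ⟨z, Set.mem_biUnion (x := ⟨_, v, rfl⟩) ⟨v, hv, rfl⟩ hz, cube_subset_unitCube hk v hz,
      by simp [z, hv0]⟩
  · let z : Fin n → ℝ := fun s => ((w s : ℕ) + 1) / ((m + 1 : ℕ) : ℝ)
    have hz : z ∈ cube n (m + 1) w := fun s _ =>
      ⟨(div_le_div_iff_of_pos_right hk').2 (by linarith), le_rfl⟩
    refine ⟨z, Set.mem_biUnion (x := ⟨_, w, rfl⟩) ⟨w, hw, rfl⟩ hz, cube_subset_unitCube hk w hz, ?_⟩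
    have : z i = ((m : ℝ) + 1) / ((m + 1 : ℕ) : ℝ) := by simp only [z, hwm]
    rw [this, Nat.cast_succ, div_self (by positivity)]

/-! ### The brick tiling of `ℤ²` -/

/-- The domino of the running-bond brick tiling of `ℤ²` that contains `p`. -/
def brick (p : Fin 2 → ℤ) : ℤ × ℤ :=
  ((p 0 + p 1) / 2, p 1)

/-- The two points of a domino of the brick tiling. -/
def brickPoints (b : ℤ × ℤ) : Finset (Fin 2 → ℤ) :=
  {![2 * b.1 - b.2, b.2], ![2 * b.1 - b.2 + 1, b.2]}

theorem mem_brickPoints (p : Fin 2 → ℤ) : p ∈ brickPoints (brick p) := by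
  simp only [brickPoints, brick, Finset.mem_insert, Finset.mem_singleton]
  rcases Int.emod_two_eq_zero_or_one (p 0 + p 1) with h | h
  · left
    ext i
    fin_cases i <;> simp; omega
  · right
    ext i
    fin_cases i <;> simp; omega

theorem rConnected_of_dist_le {X : Type*} [MetricSpace X] {r : ℝ} {S : Set X}
    (h : ∀ x ∈ S, ∀ y ∈ S, dist x y ≤ r) : RConnected r S := by
  intro x hx y hy
  refine ⟨1, ![x, y], ?_, rfl, rfl, ?_⟩
  · intro j
    fin_cases j
    exacts [hx, hy]
  · intro j
    fin_cases j
    exact h x hx y hy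

theorem rConnected_brickPoints (b : ℤ × ℤ) :
    RConnected 1 (brickPoints b : Set (Fin 2 → ℤ)) := by
  refine rConnected_of_dist_le fun x hx y hy => ?_
  simp only [brickPoints, Finset.coe_insert, Finset.coe_singleton, Set.mem_insert_iff,
    Set.mem_singleton_iff] at hx hy
  rw [dist_pi_le_iff zero_le_one]
  intro i
  rw [Int.dist_eq']
  norm_cast
  rcases hx with rfl | rfl <;> rcases hy with rfl | rfl <;> fin_cases i <;> simp

/-- A `2 × 2` block of `ℤ²` meets at most three dominoes of the brick tiling. -/
theorem exists_brick_eq (p : Fin 4 → Fin 2 → ℤ)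
    (h : ∀ i j s, p i s ≤ p j s + 1) : ∃ i j, i ≠ j ∧ brick (p i) = brick (p j) := by
  -- Consecutive rows are offset by one, so one of the two rows of a `2 × 2` block is a single
  -- domino.
  by_contra! hne
  have hx (i j) := h i j 0
  have hy (i j) := h i j 1
  have hne (i j) (hij : i ≠ j) (h1 : p i 1 = p j 1) : (p i 0 + p i 1) / 2 ≠ (p j 0 + p j 1) / 2 :=
    fun h0 => hne i j hij (Prod.ext h0 h1)
  have h01 := hne 0 1 (by decide)
  have h02 := hne 0 2 (by decide)
  have h03 := hne 0 3 (by decide)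
  have h12 := hne 1 2 (by decide)
  have h13 := hne 1 3 (by decide)
  have h23 := hne 2 3 (by decide)
  have := hx 0 1; have := hx 0 2; have := hx 0 3; have := hx 1 2; have := hx 1 3; have := hx 2 3
  have := hx 1 0; have := hx 2 0; have := hx 3 0; have := hx 2 1; have := hx 3 1; have := hx 3 2
  have := hy 0 1; have := hy 0 2; have := hy 0 3; have := hy 1 2; have := hy 1 3; have := hy 2 3
  have := hy 1 0; have := hy 2 0; have := hy 3 0; have := hy 2 1; have := hy 3 1; have := hy 3 2
  omega

/-! ### The upper bound -/

/-- Four cubes of the three-dimensional chessboard near each other, no two of them in the same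
link component, exist if no link component meets opposite faces. -/
theorem exists_near_not_linked (m : ℕ) {β : Type*} (g : (Fin 3 → Fin (m + 1)) → β)
    (h : ∀ u v w i, ReflTransGen (Linked g) u v → ReflTransGen (Linked g) u w →
      (v i : ℕ) = 0 → (w i : ℕ) ≠ m) :
    ∃ u : Fin 4 → Fin 3 → Fin (m + 1), (∀ i j, IsNear (u i) (u j)) ∧
      ∀ i j, i ≠ j → ¬ Linked g (u i) (u j) := by
  classical
  let touches (u : Fin 3 → Fin (m + 1)) (i : Fin 3) : Prop :=
    ∃ v, ReflTransGen (Linked g) u v ∧ (v i : ℕ) = 0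
  have touches_of_zero {u i} (hu : (u i : ℕ) = 0) : touches u i := ⟨u, .refl, hu⟩
  have not_touches {u i} (hu : (u i : ℕ) = m) : ¬ touches u i :=
    fun ⟨v, huv, hv⟩ => h u v u i huv .refl hv hu
  have touches_congr {u v} (huv : Linked g u v) : touches u = touches v := by
    ext i
    exact ⟨fun ⟨w, hw, h0⟩ => ⟨w, hw.head huv.symm, h0⟩, fun ⟨w, hw, h0⟩ => ⟨w, hw.head huv, h0⟩⟩
  let label (t : Fin 3 → Prop) : Fin 4 :=
    if t 0 then 0 else if t 1 then 1 else if t 2 then 2 else 3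
  -- Cubes serve as the grid vertices of the Sperner lemma; `min` only makes the indexing total.
  let idx (x y z : ℕ) : Fin 3 → Fin (m + 1) :=
    ![⟨min x m, by omega⟩, ⟨min y m, by omega⟩, ⟨min z m, by omega⟩]
  obtain ⟨x, y, z, hx, hy, hz, hL⟩ := exists_cell_all_labels m
    (fun x y z => label (touches (idx x y z)))
    (fun y _ z _ => by
      have : touches (idx 0 y z) 0 := touches_of_zero (by simp [idx])
      simp [label, this])
    (fun y _ z _ => by
      have : ¬ touches (idx m y z) 0 := not_touches (by simp [idx])
      simp only [label]
      split_ifs <;> simp_all)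
    (fun x _ z _ => by
      have : touches (idx x 0 z) 1 := touches_of_zero (by simp [idx])
      simp only [label]
      split_ifs <;> simp_all)
    (fun x _ z _ => by
      have : ¬ touches (idx x m z) 1 := not_touches (by simp [idx])
      simp only [label]
      split_ifs <;> simp_all)
    (fun x _ y _ => by
      have : touches (idx x y 0) 2 := touches_of_zero (by simp [idx])
      simp only [label]
      split_ifs <;> first | contradiction | decide)
    (fun x _ y _ => by
      have : ¬ touches (idx x y m) 2 := not_touches (by simp [idx])
      simp only [label]
      split_ifs <;> first | contradiction | decide)
  choose a ha b hb c hc hl using hL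
  refine ⟨fun l => idx (x + a l) (y + b l) (z + c l), fun i j s => ?_, fun i j hij hlink => ?_⟩
  · have := ha i; have := ha j; have := hb i; have := hb j; have := hc i; have := hc j
    fin_cases s <;> simp [idx] <;> omega
  · apply hij
    rw [← hl i, ← hl j, touches_congr hlink]

theorem admissibleConst_three_zero_two : AdmissibleConst 3 0 2 := by
  intro k hk F hF
  obtain ⟨m, rfl⟩ : ∃ m, k = m + 1 := ⟨k - 1, by omega⟩
  let f (u : Fin 3 → Fin (m + 1)) : Fin 2 → ℤ := F ⟨cube 3 (m + 1) u, u, rfl⟩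
  let g (u : Fin 3 → Fin (m + 1)) := brick (f u)
  by_cases H : ∃ u v w i, ReflTransGen (Linked g) u v ∧ ReflTransGen (Linked g) u w ∧
      (v i : ℕ) = 0 ∧ (w i : ℕ) = m
  · obtain ⟨u, v, w, i, hv, hw, hv0, hwm⟩ := H
    refine ⟨brickPoints (g u), rConnected_brickPoints _, ?_, linkComponent g u, ?_, i,
      connectsOppositeFaces_linkComponent g hv hw hv0 hwm⟩
    · exact_mod_cast Finset.card_le_two
    · rintro _ ⟨w, hw, rfl⟩
      rw [eq_of_reflTransGen_linked hw]
      exact mem_brickPoints (f w)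
  · exfalso
    obtain ⟨u, hnear, hlink⟩ := exists_near_not_linked m g
      fun u v w i hv hw hv0 hwm => H ⟨u, v, w, i, hv, hw, hv0, hwm⟩
    obtain ⟨i, j, hij, hb⟩ := exists_brick_eq (fun l => f (u l)) fun i j s => by
      have h1 : ‖f (u i) - f (u j)‖ ≤ 1 :=
        hF _ _ (zero_le_topDim_iff.2 ((cube_inter_cube_nonempty_iff hk).2 (hnear i j)))
      have h2 := (norm_le_pi_norm (f (u i) - f (u j)) s).trans h1
      rw [Int.norm_eq_abs] at h2
      have h3 : |(f (u i) - f (u j)) s| ≤ 1 := by exact_mod_cast h2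
      have h4 := (abs_le.1 h3).2
      rw [Pi.sub_apply] at h4
      omega
    exact hlink i j hij ⟨hnear i j, hb⟩

/-! ### The lower bound -/

/-- A colouring of the `27` cubes by four colours, none of whose colour classes has a component
that meets opposite faces. -/
def fourColouring (u : Fin 3 → Fin 3) : Fin 4 :=
  ![![![0, 0, 2], ![1, 1, 2], ![2, 0, 0]],
    ![![3, 3, 2], ![1, 1, 2], ![1, 1, 3]],
    ![![3, 0, 0], ![2, 0, 0], ![2, 3, 3]]] (u 0) (u 1) (u 2)

/-- The four colours as points of `ℤ²`. -/
def colourPoint : Fin 4 → Fin 2 → ℤ :=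
  ![![0, 0], ![1, 0], ![0, 1], ![1, 1]]

theorem colourPoint_injective : Function.Injective colourPoint := by
  decide

theorem norm_colourPoint_sub_le (a b : Fin 4) : ‖colourPoint a - colourPoint b‖ ≤ 1 := by
  have h : ∀ (a b : Fin 4) (i : Fin 2), |colourPoint a i - colourPoint b i| ≤ 1 := by decide
  rw [pi_norm_le_iff_of_nonneg zero_le_one]
  intro i
  rw [Int.norm_eq_abs]
  exact_mod_cast h a b i

set_option maxRecDepth 100000 in
/-- Nearness is transitive on each colour class. -/
theorem IsNear.trans_of_fourColouring_eq {u v w : Fin 3 → Fin 3} (huv : IsNear u v)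
    (hvw : IsNear v w) (hc : fourColouring u = fourColouring v)
    (hc' : fourColouring v = fourColouring w) : IsNear u w := by
  -- The hypotheses on `u` and `v` precede the quantifiers over `w`, so `decide` skips `w` for most
  -- pairs.
  have h : ∀ v₀ v₁ v₂ u₀ u₁ u₂ : Fin 3, fourColouring ![u₀, u₁, u₂] = fourColouring ![v₀, v₁, v₂] →
      IsNear ![u₀, u₁, u₂] ![v₀, v₁, v₂] → ∀ w₀ w₁ w₂ : Fin 3,
      fourColouring ![v₀, v₁, v₂] = fourColouring ![w₀, w₁, w₂] →
      IsNear ![v₀, v₁, v₂] ![w₀, w₁, w₂] → IsNear ![u₀, u₁, u₂] ![w₀, w₁, w₂] := by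
    unfold IsNear
    decide
  have e (u : Fin 3 → Fin 3) : ![u 0, u 1, u 2] = u := by
    ext i; fin_cases i <;> rfl
  have := h (v 0) (v 1) (v 2) (u 0) (u 1) (u 2)
  simp only [e] at this
  have := this hc huv (w 0) (w 1) (w 2)
  simp only [e] at this
  exact this hc' hvw

/-- Take `u` at the face `z_i = 0`. By transitivity the cubes near `u` and those not near `u` form
disjoint closed sets, so connectedness leaves only cubes near `u`. Their `i`th index is at most `1`,
whereas the opposite face needs `2`. -/
theorem not_connectsOppositeFaces_of_fourColouring_eq {U : Set (Fin 3 → Fin 3)} {a : Fin 4}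
    (hU : ∀ u ∈ U, fourColouring u = a) (i : Fin 3) :
    ¬ ConnectsOppositeFaces i (⋃ u ∈ U, cube 3 3 u) := by
  rintro ⟨-, hS, ⟨x, hx, -, hx0⟩, ⟨y, hy, -, hy1⟩⟩
  have hk : 1 ≤ 3 := by norm_num
  simp only [Set.mem_iUnion] at hx
  obtain ⟨u, hu, hxu⟩ := hx
  have closed (p : (Fin 3 → Fin 3) → Prop) : IsClosed (⋃ v ∈ {v ∈ U | p v}, cube 3 3 v) :=
    (Set.toFinite _).isClosed_biUnion fun v _ => isClosed_cube v
  have hcover : (⋃ v ∈ U, cube 3 3 v) ⊆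
      (⋃ v ∈ {v ∈ U | IsNear u v}, cube 3 3 v) ∪ ⋃ v ∈ {v ∈ U | ¬ IsNear u v}, cube 3 3 v := by
    intro z hz
    simp only [Set.mem_iUnion] at hz
    obtain ⟨v, hv, hzv⟩ := hz
    by_cases huv : IsNear u v
    · exact Or.inl (Set.mem_biUnion (x := v) ⟨hv, huv⟩ hzv)
    · exact Or.inr (Set.mem_biUnion (x := v) ⟨hv, huv⟩ hzv)
  have hdisj : (⋃ v ∈ U, cube 3 3 v) ∩
      ((⋃ v ∈ {v ∈ U | IsNear u v}, cube 3 3 v) ∩ ⋃ v ∈ {v ∈ U | ¬ IsNear u v}, cube 3 3 v) = ∅ := by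
    refine Set.eq_empty_of_forall_notMem ?_
    rintro z ⟨-, hz1, hz2⟩
    simp only [Set.mem_iUnion] at hz1 hz2
    obtain ⟨v, ⟨hv, huv⟩, hzv⟩ := hz1
    obtain ⟨w, ⟨hw, huw⟩, hzw⟩ := hz2
    exact huw (huv.trans_of_fourColouring_eq
      ((cube_inter_cube_nonempty_iff hk).1 ⟨z, hzv, hzw⟩)
      ((hU u hu).trans (hU v hv).symm) ((hU v hv).trans (hU w hw).symm))
  rcases isPreconnected_iff_subset_of_disjoint_closed.1 hS.isPreconnected _ _
    (closed _) (closed _) hcover hdisj with h | h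
  · have hy := h hy
    simp only [Set.mem_iUnion] at hy
    obtain ⟨v, ⟨hv, huv⟩, hyv⟩ := hy
    have h1 := (hxu i (Set.mem_univ i)).1
    have h2 := (hyv i (Set.mem_univ i)).2
    rw [hx0, div_le_iff₀ (by norm_num), zero_mul] at h1
    rw [hy1, le_div_iff₀ (by norm_num)] at h2
    have h1 : (u i : ℕ) ≤ 0 := by exact_mod_cast h1
    have h2 : 3 ≤ (v i : ℕ) + 1 := by
      have : ((3 : ℕ) : ℝ) ≤ ((v i : ℕ) + 1 : ℕ) := by push_cast at h2 ⊢; linarith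
      exact_mod_cast this
    have := huv i
    omega
  · have hx := h (Set.mem_biUnion hu hxu)
    simp only [Set.mem_iUnion] at hx
    obtain ⟨v, ⟨_, huv⟩, hxv⟩ := hx
    exact huv ((cube_inter_cube_nonempty_iff hk).1 ⟨x, hxu, hxv⟩)

theorem two_le_of_admissibleConst {C : ℝ} (h : AdmissibleConst 3 0 C) : 2 ≤ C := by
  by_contra! hC
  have hidx (K : cubes 3 3) : ∃ u, cube 3 3 u = K := K.2
  choose idx hidx using hidx
  obtain ⟨P, -, hP, 𝒮, h𝒮, i, hi⟩ := h 3 (by norm_num) (fun K => colourPoint (fourColouring (idx K)))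
    fun K₁ K₂ _ => norm_colourPoint_sub_le _ _
  have hP : P.card ≤ 1 := by
    have : (P.card : ℝ) < (2 : ℕ) := by push_cast; linarith
    have : P.card < 2 := by exact_mod_cast this
    omega
  have heq : (⋃ K ∈ 𝒮, (K : Set (Fin 3 → ℝ))) = ⋃ u ∈ idx '' 𝒮, cube 3 3 u := by
    rw [Set.biUnion_image]
    simp only [hidx]
  -- A point of the crossing set supplies a cube of `𝒮`, whose colour is then the only one.
  obtain ⟨x, hx, -⟩ := hi.2.2.1
  simp only [Set.mem_iUnion] at hx
  obtain ⟨K₀, hK₀, -⟩ := hx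
  rw [heq] at hi
  refine not_connectsOppositeFaces_of_fourColouring_eq (a := fourColouring (idx K₀)) ?_ i hi
  rintro _ ⟨K, hK, rfl⟩
  exact colourPoint_injective (Finset.card_le_one.1 hP _ (h𝒮 hK) _ (h𝒮 hK₀))

end Chessboard

theorem mainTheorem7 : Chessboard.IsOptimalConst 3 0 2 :=
  ⟨⟨two_pos, Chessboard.admissibleConst_three_zero_two⟩,
    fun _ hC => Chessboard.two_le_of_admissibleConst hC.2⟩
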